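/- Let $1\le k\le n$, let $S^n$ be the unit sphere in $\mathbb R^{n+1}$, and let $a\in\mathbb R^{n+1}$ with $|a|<1$. Put $s_a=\sqrt{1-|a|^2}$, let $P_a x=\frac{a\cdot x}{|a|^2}a$ be the orthogonal projection onto the direction of $a$ (with $P_a=0$ if $a=0$), let $Q_a=I-P_a$, and let $$\varphi_a x=\frac{a-P_a x-s_aQ_a x}{1-x\cdot a}\qquad (x\cdot a\ne 1).$$ Let $\mathrm{Gr}_a(n+1,k)$ be the set of $k$-dimensional affine planes in $\mathbb R^{n+1}$ passing through $a$. For $\tau\in \mathrm{Gr}_a(n+1,k)$ let $\varphi_a\tau\in\mathrm{Gr}_0(n+1,k)$ be the image of $\tau$ under $\varphi_a$, that is, the affine span of $\{\varphi_a x: x\in\tau,\ x\cdot a\neq 1\}$, which is a $k$-dimensional plane through the origin. For a function $f$ on $S^n$, a function $\Phi$ on $\mathrm{Gr}_0(n+1,k)$, $\tau\in\mathrm{Gr}_a(n+1,k)$ and $y\in S^n$, define $$(F_af)(\tau)=\int_{S^n\cap\tau}f\,d\sigma,\qquad (M_af)(y)=\Big(\frac{s_a}{1-a\cdot y}\Big)^{k-1}f(\varphi_a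 y),\qquad (N_a\Phi)(\tau)=\Phi(\varphi_a\tau),$$ where $\sigma$ is the surface area measure on the $(k-1)$-dimensional sphere $S^n\cap\tau$ (the counting measure if $k=1$), and let $F_0$ be the transform $F_a$ for $a=0$. Then for every $f\in C(S^n)$, $$F_af=N_aF_0M_af .$$ -/

import Mathlib

open MeasureTheory Metric Module
open scoped RealInnerProductSpace

noncomputable section

namespace ShiftedFunk

/-- The Euclidean space `ℝ^(n+1)`. -/
abbrev E (n : ℕ) : Type := EuclideanSpace ℝ (Fin (n + 1))

/-- The unit sphere `S^n` in `ℝ^(n+1)`. -/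
abbrev Sph (n : ℕ) : Type := sphere (0 : E n) 1

/-- `s_a = √(1 - |a|²)`. -/
def s {n : ℕ} (a : E n) : ℝ := √(1 - ‖a‖ ^ 2)

/-- The orthogonal projection `P_a x = ((a · x) / |a|²) a` onto the direction of `a`.
For `a = 0` this is the zero map, the usual convention. -/
def P {n : ℕ} (a x : E n) : E n := (⟪a, x⟫ / ‖a‖ ^ 2) • a

/-- The complementary projection `Q_a = I - P_a`, onto the orthogonal complement of `a`. -/
def Q {n : ℕ} (a x : E n) : E n := x - P a x

/-- The Möbius map `φ_a x = (a - P_a x - s_a Q_a x) / (1 - x · a)`, meaningful for `x · a ≠ 1`.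
For `a = 0` it is `x ↦ -x`. -/
def mobius {n : ℕ} (a x : E n) : E n :=
  (1 - ⟪x, a⟫)⁻¹ • (a - P a x - s a • Q a x)

/-- `Gr_a(n+1, k)`: the `k`-dimensional affine planes in `ℝ^(n+1)` passing through `a`. -/
def Gr {n : ℕ} (a : E n) (k : ℕ) : Type :=
  {τ : AffineSubspace ℝ (E n) // a ∈ τ ∧ finrank ℝ τ.direction = k}

/-- The shifted Funk transform `(F_a f)(τ) = ∫_{S^n ∩ τ} f dσ`. The section `S^n ∩ τ` is a
`(k-1)`-dimensional sphere, and `σ` is its surface area measure, i.e. the `(k-1)`-dimensional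
Hausdorff measure normalized so as to agree with Lebesgue measure on `ℝ^(k-1)`
(the counting measure if `k = 1`). -/
def funk {𝕜 : Type*} [RCLike 𝕜] {n : ℕ} (a : E n) (k : ℕ) (f : Sph n → 𝕜) (τ : Gr a k) : 𝕜 :=
  ∫ x in {x : Sph n | (x : E n) ∈ τ.1}, f x ∂μHE[k - 1]

theorem s_sq {n : ℕ} {a : E n} (ha : a ∈ ball (0 : E n) 1) : s a ^ 2 = 1 - ‖a‖ ^ 2 := by
  rw [mem_ball_zero_iff] at ha
  exact Real.sq_sqrt (by nlinarith [norm_nonneg a])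

theorem s_pos {n : ℕ} {a : E n} (ha : a ∈ ball (0 : E n) 1) : 0 < s a := by
  rw [mem_ball_zero_iff] at ha
  exact Real.sqrt_pos.2 (by nlinarith [norm_nonneg a])

theorem inner_P {n : ℕ} (a x : E n) : ⟪a, P a x⟫ = ⟪a, x⟫ := by
  rcases eq_or_ne a 0 with rfl | h
  · simp
  · have : ‖a‖ ≠ 0 := by simpa using h
    rw [P, inner_smul_right, real_inner_self_eq_norm_sq]
    field_simp

theorem P_self {n : ℕ} (a : E n) : P a a = a := by
  rcases eq_or_ne a 0 with rfl | h
  · simp [P]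
  · have : ‖a‖ ≠ 0 := by simpa using h
    rw [P, real_inner_self_eq_norm_sq, div_self (by positivity), one_smul]

theorem P_add {n : ℕ} (a x y : E n) : P a (x + y) = P a x + P a y := by
  simp only [P, inner_add_right, add_div, add_smul]

theorem P_smul {n : ℕ} (a : E n) (c : ℝ) (x : E n) : P a (c • x) = c • P a x := by
  simp only [P, inner_smul_right, smul_smul, mul_div_assoc]

theorem P_P {n : ℕ} (a x : E n) : P a (P a x) = P a x := by
  conv_lhs => rw [P, inner_P]
  rfl

theorem one_sub_inner_pos {n : ℕ} {a x : E n} (ha : a ∈ ball (0 : E n) 1) (hx : ‖x‖ ≤ 1) :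
    0 < 1 - ⟪x, a⟫ := by
  rw [mem_ball_zero_iff] at ha
  have := real_inner_le_norm x a
  nlinarith [norm_nonneg a, norm_nonneg x]

theorem norm_mobius_of_norm_eq_one {n : ℕ} {a x : E n} (ha : a ∈ ball (0 : E n) 1)
    (hx : ‖x‖ = 1) : ‖mobius a x‖ = 1 := by
  have hd := one_sub_inner_pos ha hx.le
  have hPP : ⟪P a x, x⟫ = ‖P a x‖ ^ 2 := by
    rcases eq_or_ne a 0 with rfl | h
    · simp [P]
    · have : ‖a‖ ≠ 0 := by simpa using h
      rw [P, norm_smul, real_inner_smul_left, mul_pow, Real.norm_eq_abs, sq_abs]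
      field_simp
  have hN : ‖a‖ ^ 2 * ‖P a x‖ ^ 2 = ⟪x, a⟫ ^ 2 := by
    rcases eq_or_ne a 0 with rfl | h
    · simp
    · have : ‖a‖ ≠ 0 := by simpa using h
      rw [P, norm_smul, mul_pow, Real.norm_eq_abs, sq_abs, real_inner_comm]
      field_simp
  have h1 : ⟪a, P a x⟫ = ⟪x, a⟫ := by rw [inner_P, real_inner_comm]
  have key : ‖a - P a x - s a • Q a x‖ ^ 2 = (1 - ⟪x, a⟫) ^ 2 := by
    have e : ‖a - P a x - s a • Q a x‖ ^ 2 =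
        ‖a‖ ^ 2 - 2 * ⟪x, a⟫ + ‖P a x‖ ^ 2 + s a ^ 2 * (1 - ‖P a x‖ ^ 2) := by
      have hx2 : ⟪x, x⟫ = 1 := by rw [real_inner_self_eq_norm_sq, hx]; norm_num
      have c1 : ⟪x, P a x⟫ = ‖P a x‖ ^ 2 := by rw [real_inner_comm, hPP]
      have c2 : ⟪P a x, a⟫ = ⟪x, a⟫ := by rw [real_inner_comm, h1]
      have c3 : ⟪a, x⟫ = ⟪x, a⟫ := real_inner_comm _ _
      rw [← real_inner_self_eq_norm_sq (a - P a x - s a • Q a x)]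
      simp only [Q, inner_sub_left, inner_sub_right, real_inner_smul_left, inner_smul_right,
        h1, hPP, c1, c2, c3, hx2, real_inner_self_eq_norm_sq]
      ring
    rw [e, s_sq ha]
    linear_combination hN
  have h2 : ‖a - P a x - s a • Q a x‖ = 1 - ⟪x, a⟫ :=
    (pow_left_inj₀ (norm_nonneg _) hd.le two_ne_zero).1 key
  rw [mobius, norm_smul, h2, norm_inv, Real.norm_of_nonneg hd.le, inv_mul_cancel₀ hd.ne']

/-- The restriction of `φ_a` to a map of the sphere into itself. -/
def mobiusSphere {n : ℕ} {a : E n} (ha : a ∈ ball (0 : E n) 1) (y : Sph n) : Sph n :=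
  ⟨mobius a y, mem_sphere_zero_iff_norm.2
    (norm_mobius_of_norm_eq_one ha (mem_sphere_zero_iff_norm.1 y.2))⟩

/-- `(M_a f)(y) = (s_a / (1 - a · y))^(k-1) f(φ_a y)`. -/
def M {𝕜 : Type*} [RCLike 𝕜] {n : ℕ} {a : E n} (ha : a ∈ ball (0 : E n) 1) (k : ℕ)
    (f : Sph n → 𝕜) (y : Sph n) : 𝕜 :=
  (((s a / (1 - ⟪a, (y : E n)⟫)) ^ (k - 1) : ℝ) : 𝕜) * f (mobiusSphere ha y)

/-- The plane `φ_a τ`. As a set, the image of `τ` under the projective map `φ_a` (which is defined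
off the hyperplane `x · a = 1`) is a plane with its intersection with that hyperplane removed; the
affine span restores the removed points. -/
def mobiusPlane {n : ℕ} (a : E n) (τ : AffineSubspace ℝ (E n)) : AffineSubspace ℝ (E n) :=
  affineSpan ℝ (mobius a '' {x : E n | x ∈ τ ∧ ⟪x, a⟫ ≠ 1})

/-- The linear map `P_a + s_a Q_a`. -/
def A {n : ℕ} (a : E n) : E n →ₗ[ℝ] E n where
  toFun x := P a x + s a • Q a x
  map_add' x y := by simp only [Q, P_add, smul_sub, smul_add]; abel
  map_smul' c x := by
    simp only [Q, P_smul, smul_sub, smul_add, RingHom.id_apply, smul_comm c (s a)]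

theorem A_injective {n : ℕ} {a : E n} (ha : a ∈ ball (0 : E n) 1) :
    Function.Injective (A a) := by
  rw [injective_iff_map_eq_zero]
  intro x hx
  have hs := (s_pos ha).ne'
  have hx' : P a x + s a • (x - P a x) = 0 := hx
  have h0 : P a x = 0 := by
    have h := congrArg (fun z => ⟪a, z⟫) hx'
    simp only [inner_add_right, inner_sub_right, inner_smul_right, inner_P, sub_self, mul_zero,
      add_zero, inner_zero_right] at h
    rw [P, h, zero_div, zero_smul]
  rw [h0, zero_add, sub_zero] at hx'
  exact (smul_eq_zero.1 hx').resolve_left hs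

theorem mobius_add {n : ℕ} (a : E n) (v : E n) :
    mobius a (a + v) = (-(1 - ⟪a + v, a⟫)⁻¹) • A a v := by
  have : a - P a (a + v) - s a • Q a (a + v) = - A a v := by
    simp only [Q, P_add, P_self, A, LinearMap.coe_mk, AddHom.coe_mk]
    have : a + v - (a + P a v) = v - P a v := by abel
    rw [this]; abel
  rw [mobius, this, smul_neg, neg_smul]

theorem one_sub_inner_self_ne {n : ℕ} {a : E n} (ha : a ∈ ball (0 : E n) 1) :
    ⟪a, a⟫ ≠ 1 := by
  have := one_sub_inner_pos ha (x := a) (mem_ball_zero_iff.1 ha).le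
  linarith

theorem mobiusPlane_eq {n : ℕ} {a : E n} (ha : a ∈ ball (0 : E n) 1)
    {τ : AffineSubspace ℝ (E n)} (hτ : a ∈ τ) :
    mobiusPlane a τ = (τ.direction.map (A a)).toAffineSubspace := by
  apply le_antisymm
  · refine affineSpan_le.2 ?_
    rintro _ ⟨x, ⟨hx, -⟩, rfl⟩
    have hv : x - a ∈ τ.direction := AffineSubspace.vsub_mem_direction hx hτ
    have := mobius_add a (x - a)
    rw [add_sub_cancel] at this
    rw [this]
    exact Submodule.smul_mem _ _ (Submodule.mem_map_of_mem hv)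
  · rintro _ ⟨v, hv, rfl⟩
    have h0 : (0 : E n) ∈ mobiusPlane a τ := by
      refine subset_affineSpan ℝ _ ⟨a, ⟨hτ, one_sub_inner_self_ne ha⟩, ?_⟩
      have := mobius_add a 0
      simpa using this
    -- a nonzero multiple of `v` avoids the exceptional hyperplane
    obtain ⟨c, hc, hne⟩ : ∃ c : ℝ, c ≠ 0 ∧ ⟪a + c • v, a⟫ ≠ 1 := by
      by_contra! h
      have h1 := h 1 one_ne_zero
      have h2 := h 2 two_ne_zero
      simp only [inner_add_left, real_inner_smul_left] at h1 h2
      exact one_sub_inner_self_ne ha (by linarith)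
    have h1 : mobius a (a + c • v) ∈ mobiusPlane a τ := by
      refine subset_affineSpan ℝ _ ⟨_, ⟨?_, hne⟩, rfl⟩
      have := AffineSubspace.vadd_mem_of_mem_direction (τ.direction.smul_mem c hv) hτ
      rwa [vadd_eq_add, add_comm (c • v) a] at this
    rw [mobius_add a, map_smul, smul_smul] at h1
    set d : ℝ := -(1 - ⟪a + c • v, a⟫)⁻¹ * c with hd
    have hd0 : d ≠ 0 := mul_ne_zero (neg_ne_zero.2 (inv_ne_zero (sub_ne_zero.2 hne.symm))) hc
    have h2 := AffineMap.lineMap_mem d⁻¹ h0 h1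
    rwa [AffineMap.lineMap_apply_module, smul_zero, zero_add, smul_smul,
      inv_mul_cancel₀ hd0, one_smul] at h2

/-- `φ_a` as a map from `Gr_a(n+1, k)` to `Gr_o(n+1, k)`. -/
def mobiusGr {n : ℕ} {a : E n} (ha : a ∈ ball (0 : E n) 1) {k : ℕ} (τ : Gr a k) :
    Gr (0 : E n) k :=
  ⟨mobiusPlane a τ.1, by
    rw [mobiusPlane_eq ha τ.2.1]
    exact ⟨Submodule.zero_mem _, by
      rw [Submodule.toAffineSubspace_direction,
        (Submodule.equivMapOfInjective (A a) (A_injective ha) _).finrank_eq.symm, τ.2.2]⟩⟩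

/-- `(N_a Φ)(τ) = Φ(φ_a τ)`, for `Φ` a function on `Gr_o(n+1, k)` and `τ ∈ Gr_a(n+1, k)`. -/
def N {𝕜 : Type*} {n : ℕ} {a : E n} (ha : a ∈ ball (0 : E n) 1) {k : ℕ}
    (Φ : Gr (0 : E n) k → 𝕜) (τ : Gr a k) : 𝕜 :=
  Φ (mobiusGr ha τ)

end ShiftedFunk

end

/-! ### Hausdorff measure under maps with a conformal factor. -/

noncomputable section

open scoped NNReal ENNReal

/-! The identity is a change of variables. On the sphere `φ_a` is an involution exchanging the
sections by `τ` and by `φ_a τ` (`mobius_mem_iff`), and it satisfies |φx - φy|² = c(x) c(y) |x - y|²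
with c(y) = s_a / (1 - a·y) (`dist_mobiusSphere_sq`). It should therefore scale (k-1)-dimensional
measure by c^(k-1), the weight in `M`.

No Jacobian is computed. Where c is nearly constant the map is Lipschitz with nearly that constant,
which bounds the measure of an image from above. Applying this bound to the inverse, which is the
map itself, and using c(φx) c(x) = 1 gives the reverse inequality. -/

/-- A map scaling distances by the geometric mean of the values of `c` at the endpoints scales
`d`-dimensional Euclidean Hausdorff measure by at most the density `c ^ d`. -/
theorem euclideanHausdorffMeasure_image_le_lintegral {X Y : Type*} [MetricSpace X]
    [MeasurableSpace X] [BorelSpace X] [MetricSpace Y] [MeasurableSpace Y] [BorelSpace Y]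
    {g : X → Y} {c : X → ℝ≥0} (hc : Measurable c) (hpos : ∀ x, 0 < c x)
    (hg : ∀ x y, dist (g x) (g y) ^ 2 = c x * c y * dist x y ^ 2) (d : ℕ)
    {S : Set X} (hS : MeasurableSet S) :
    μHE[d] (g '' S) ≤ ∫⁻ x in S, (c x : ℝ≥0∞) ^ d ∂μHE[d] := by
  have key : ∀ t : ℝ≥0, 1 < t →
      μHE[d] (g '' S) ≤ (t : ℝ≥0∞) ^ d * ∫⁻ x in S, (c x : ℝ≥0∞) ^ d ∂μHE[d] := by
    intro t ht
    have ht0 : 0 < t := zero_lt_one.trans ht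
    -- Slices on which `c` varies by a factor at most `t`: the Lipschitz constant `t ^ (m + 1)`
    -- exceeds the lower bound of `c` by exactly `t`, so each slice loses `t ^ d`. Then `t` tends to
    -- 1.
    set T : ℤ → Set X := fun m => S ∩ c ⁻¹' Set.Ico (t ^ m) (t ^ (m + 1)) with hT
    have hTm : ∀ m, MeasurableSet (T m) := fun m => hS.inter (hc measurableSet_Ico)
    have hTd : Pairwise (Function.onFun Disjoint T) := by
      intro i j hij
      refine Set.disjoint_left.2 fun x hxi hxj => ?_
      have h1 := hxi.2.1.trans_lt hxj.2.2
      have h2 := hxj.2.1.trans_lt hxi.2.2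
      rw [zpow_lt_zpow_iff_right₀ ht] at h1 h2
      omega
    have hTU : S = ⋃ m, T m := by
      ext x
      simp only [Set.mem_iUnion, hT, Set.mem_inter_iff, exists_and_left]
      refine ⟨fun h => ⟨h, ?_⟩, fun h => h.1⟩
      exact NNReal.exists_mem_Ico_zpow (hpos x).ne' ht
    have hpiece : ∀ m, μHE[d] (g '' T m) ≤
        (t : ℝ≥0∞) ^ d * ∫⁻ x in T m, (c x : ℝ≥0∞) ^ d ∂μHE[d] := by
      intro m
      have hlip : LipschitzOnWith (t ^ (m + 1)) g (T m) := by
        refine LipschitzOnWith.of_dist_le_mul fun x hx y hy => ?_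
        refine abs_le_of_sq_le_sq' ?_ (by positivity) |>.2
        rw [hg, mul_pow, sq ((t ^ (m + 1) : ℝ≥0) : ℝ)]
        have h1 : (c x : ℝ) ≤ (t ^ (m + 1) : ℝ≥0) := NNReal.coe_le_coe.2 hx.2.2.le
        have h2 : (c y : ℝ) ≤ (t ^ (m + 1) : ℝ≥0) := NNReal.coe_le_coe.2 hy.2.2.le
        gcongr
      have hH := hlip.hausdorffMeasure_image_le (Nat.cast_nonneg (α := ℝ) d)
      calc μHE[d] (g '' T m) ≤ ((t ^ (m + 1) : ℝ≥0) : ℝ≥0∞) ^ d * μHE[d] (T m) := by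
            simp only [Measure.euclideanHausdorffMeasure_def, Measure.smul_apply]
            rw [ENNReal.rpow_natCast] at hH
            simp only [ENNReal.smul_def, smul_eq_mul]
            rw [mul_left_comm]
            gcongr
        _ = (t : ℝ≥0∞) ^ d * ∫⁻ x in T m, (((t ^ m : ℝ≥0) : ℝ≥0∞)) ^ d ∂μHE[d] := by
            rw [setLIntegral_const, ← mul_assoc, ← mul_pow, ← ENNReal.coe_mul,
              zpow_add_one₀ ht0.ne', mul_comm t]
        _ ≤ _ := by
            gcongr 1
            refine setLIntegral_mono (by fun_prop) fun x hx => ?_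
            gcongr
            exact hx.2.1
    calc μHE[d] (g '' S) = μHE[d] (⋃ m, g '' T m) := by rw [← Set.image_iUnion, ← hTU]
      _ ≤ ∑' m, μHE[d] (g '' T m) := measure_iUnion_le _
      _ ≤ ∑' m, (t : ℝ≥0∞) ^ d * ∫⁻ x in T m, (c x : ℝ≥0∞) ^ d ∂μHE[d] :=
          ENNReal.tsum_le_tsum hpiece
      _ = (t : ℝ≥0∞) ^ d * ∫⁻ x in S, (c x : ℝ≥0∞) ^ d ∂μHE[d] := by
          rw [ENNReal.tsum_mul_left, ← lintegral_iUnion hTm hTd, ← hTU]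
  have hlim : Filter.Tendsto
      (fun t : ℝ≥0 => (t : ℝ≥0∞) ^ d * ∫⁻ x in S, (c x : ℝ≥0∞) ^ d ∂μHE[d])
      (nhdsWithin 1 (Set.Ioi 1)) (nhds (1 * ∫⁻ x in S, (c x : ℝ≥0∞) ^ d ∂μHE[d])) := by
    -- The integral may be infinite; the product still converges because the other limit, 1, is
    -- nonzero.
    refine ENNReal.Tendsto.mul_const ?_ (Or.inl one_ne_zero)
    have : Continuous fun t : ℝ≥0 => (t : ℝ≥0∞) ^ d := by
      simp only [← ENNReal.coe_pow]
      fun_prop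
    simpa using (this.tendsto 1).mono_left nhdsWithin_le_nhds
  rw [one_mul] at hlim
  exact ge_of_tendsto hlim (Filter.eventually_of_mem self_mem_nhdsWithin key)

/-- Conformal change of variables for a measurable involution. -/
theorem map_withDensity_euclideanHausdorffMeasure_of_involutive {X : Type*} [MetricSpace X]
    [MeasurableSpace X] [BorelSpace X] {e : X → X} (he : Measurable e)
    (hinv : Function.Involutive e) {c : X → ℝ≥0} (hc : Measurable c)
    (hce : ∀ x, c (e x) * c x = 1)
    (hg : ∀ x y, dist (e x) (e y) ^ 2 = c x * c y * dist x y ^ 2) (d : ℕ) :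
    Measure.map e ((μHE[d] : Measure X).withDensity fun x => ((c x ^ d : ℝ≥0) : ℝ≥0∞)) =
      μHE[d] := by
  have hpos : ∀ x, 0 < c x := fun x =>
    pos_iff_ne_zero.2 fun h => zero_ne_one (α := ℝ≥0) (by simpa [h] using hce x)
  have hcm : Measurable fun x => ((c x ^ d : ℝ≥0) : ℝ≥0∞) := by fun_prop
  have hle : Measure.map e (μHE[d] : Measure X) ≤
      (μHE[d] : Measure X).withDensity fun x => ((c x ^ d : ℝ≥0) : ℝ≥0∞) := by
    refine Measure.le_iff.2 fun S hS => ?_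
    rw [Measure.map_apply he hS, withDensity_apply _ hS,
      ← Set.image_eq_preimage_of_inverse hinv hinv]
    simpa only [ENNReal.coe_pow] using
      euclideanHausdorffMeasure_image_le_lintegral hc hpos hg d hS
  have hint : ∀ h : X → ℝ≥0∞, Measurable h →
      ∫⁻ x, h (e x) ∂μHE[d] ≤ ∫⁻ x, ((c x ^ d : ℝ≥0) : ℝ≥0∞) * h x ∂μHE[d] := by
    intro h hh
    have := lintegral_mono' hle (le_refl h)
    rwa [lintegral_map hh he, lintegral_withDensity_eq_lintegral_mul _ hcm hh] at this
  refine le_antisymm (Measure.le_iff.2 fun S hS => ?_) (Measure.le_iff.2 fun S hS => ?_)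
  · rw [Measure.map_apply he hS, withDensity_apply _ (he hS), ← lintegral_indicator (he hS),
      ← lintegral_indicator_one hS]
    -- The factor `c (e x) ^ d` becomes the wanted density after composing with `e`, and cancels
    -- against `c x ^ d` on the other side.
    have := hint (fun x => S.indicator 1 x * ((c (e x) ^ d : ℝ≥0) : ℝ≥0∞))
      ((measurable_one.indicator hS).mul (hcm.comp he))
    simp only [hinv _] at this
    calc _ = ∫⁻ x, S.indicator 1 (e x) * ((c x ^ d : ℝ≥0) : ℝ≥0∞) ∂μHE[d] := by
          congr 1 with x
          by_cases hx : e x ∈ S <;> simp [hx]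
      _ ≤ _ := this
      _ = _ := by
          congr 1 with x
          rw [mul_left_comm, ← ENNReal.coe_mul, ← mul_pow, mul_comm (c x), hce]
          simp
  · rw [Measure.map_apply he hS, withDensity_apply _ (he hS), ← lintegral_indicator (he hS)]
    have := hint _ (measurable_one.indicator (he hS) : Measurable ((e ⁻¹' S).indicator 1))
    calc μHE[d] S = ∫⁻ x, (e ⁻¹' S).indicator 1 (e x) ∂μHE[d] := by
          rw [← lintegral_indicator_one hS]
          congr 1 with x
          have hx : e x ∈ e ⁻¹' S ↔ x ∈ S := by rw [Set.mem_preimage, hinv]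
          by_cases h : x ∈ S
          · rw [Set.indicator_of_mem h, Set.indicator_of_mem (hx.2 h), Pi.one_apply, Pi.one_apply]
          · rw [Set.indicator_of_notMem h, Set.indicator_of_notMem (mt hx.1 h)]
      _ ≤ _ := this
      _ = _ := by
          congr 1 with x
          by_cases hx : e x ∈ S <;> simp [hx]

/-! ### Algebra of the Möbius map. -/

namespace ShiftedFunk

variable {n : ℕ} {a : E n}

theorem inner_A (a v : E n) : ⟪A a v, a⟫ = ⟪v, a⟫ := by
  have h : ⟪P a v, a⟫ = ⟪v, a⟫ := by rw [real_inner_comm, inner_P, real_inner_comm]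
  change ⟪P a v + s a • (v - P a v), a⟫ = _
  rw [inner_add_left, real_inner_smul_left, inner_sub_left, h, sub_self, mul_zero, add_zero]

theorem inner_smul_self (a v : E n) : ⟪v, a⟫ • a = ‖a‖ ^ 2 • P a v := by
  rcases eq_or_ne a 0 with rfl | h
  · simp
  · have : ‖a‖ ≠ 0 := by simpa using h
    rw [P, smul_smul, real_inner_comm]
    congr 1
    field_simp

theorem P_A (a v : E n) : P a (A a v) = P a v := by
  rw [P, real_inner_comm, inner_A, real_inner_comm]
  rfl

/-- Counterpart of `mobius_add`. It holds because A² v = P v + s² Q v = s² v + |a|² P v, and |a|² P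
v = (v·a) a. Since `A a` is onto, it yields involutivity and the correspondence of planes. -/
theorem mobius_A (ha : a ∈ ball (0 : E n) 1) {v : E n} (hv : ⟪v, a⟫ ≠ 1) :
    mobius a (A a v) = a + (-(s a ^ 2 / (1 - ⟪v, a⟫))) • v := by
  have hd : 1 - ⟪v, a⟫ ≠ 0 := sub_ne_zero.2 hv.symm
  have hQ : Q a (A a v) = s a • Q a v := by
    rw [Q, P_A]
    exact add_sub_cancel_left _ _
  have key : a - P a v - s a • s a • Q a v = (1 - ⟪v, a⟫) • a - s a ^ 2 • v := by
    rw [sub_smul, inner_smul_self, one_smul, Q, smul_smul, ← sq, s_sq ha]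
    module
  rw [mobius, inner_A, P_A, hQ, key, smul_sub, smul_smul, inv_mul_cancel₀ hd, one_smul, smul_smul,
    neg_smul, ← sub_eq_add_neg, div_eq_inv_mul]

theorem A_surjective (ha : a ∈ ball (0 : E n) 1) : Function.Surjective (A a) :=
  LinearMap.injective_iff_surjective.1 (A_injective ha)

theorem one_sub_inner_mobius (ha : a ∈ ball (0 : E n) 1) {x : E n} (hx : ⟪x, a⟫ ≠ 1) :
    1 - ⟪mobius a x, a⟫ = s a ^ 2 / (1 - ⟪x, a⟫) := by
  obtain ⟨v, rfl⟩ := A_surjective ha x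
  rw [inner_A] at hx ⊢
  have hd : 1 - ⟪v, a⟫ ≠ 0 := sub_ne_zero.2 hx.symm
  rw [mobius_A ha hx, inner_add_left, real_inner_smul_left, real_inner_self_eq_norm_sq, s_sq ha]
  field_simp
  ring

theorem mobius_mobius (ha : a ∈ ball (0 : E n) 1) {x : E n} (hx : ⟪x, a⟫ ≠ 1) :
    mobius a (mobius a x) = x := by
  have h := one_sub_inner_mobius ha hx
  obtain ⟨v, rfl⟩ := A_surjective ha x
  rw [inner_A] at hx h
  have hd : 1 - ⟪v, a⟫ ≠ 0 := sub_ne_zero.2 hx.symm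
  have hs := (s_pos ha).ne'
  rw [mobius_A ha hx] at h ⊢
  rw [mobius_add, h, map_smul, smul_smul]
  convert one_smul ℝ _ using 2
  field_simp

theorem mobius_mem_iff (ha : a ∈ ball (0 : E n) 1) {τ : AffineSubspace ℝ (E n)} (hτ : a ∈ τ)
    {x : E n} (hx : ⟪x, a⟫ ≠ 1) : mobius a x ∈ τ ↔ x ∈ mobiusPlane a τ := by
  constructor
  · intro h
    refine subset_affineSpan ℝ _ ⟨mobius a x, ⟨h, fun h1 => ?_⟩, mobius_mobius ha hx⟩
    have h2 := one_sub_inner_mobius ha hx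
    rw [h1, sub_self] at h2
    exact (div_ne_zero (pow_ne_zero 2 (s_pos ha).ne') (sub_ne_zero.2 hx.symm)) h2.symm
  · rw [mobiusPlane_eq ha hτ]
    rintro ⟨v, hv, rfl⟩
    rw [inner_A] at hx
    rw [mobius_A ha hx, add_comm a]
    exact AffineSubspace.vadd_mem_of_mem_direction (τ.direction.smul_mem _ hv) hτ

theorem inner_P_P (a x y : E n) : ⟪P a x, P a y⟫ = ⟪P a x, y⟫ := by
  rw [P, real_inner_smul_left, real_inner_smul_left, inner_P]

theorem norm_sq_mul_inner_P (a x y : E n) : ‖a‖ ^ 2 * ⟪P a x, y⟫ = ⟪x, a⟫ * ⟪y, a⟫ := by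
  rw [← real_inner_smul_left, ← inner_smul_self, real_inner_smul_left, real_inner_comm a y]

/-- The conformality identity in polarized form: on the unit sphere 1 - x·y is half the squared
chord, so dividing by the two denominators gives `dist_mobiusSphere_sq`. -/
theorem inner_mobius_mobius (ha : a ∈ ball (0 : E n) 1) {x y : E n} (hx : ⟪x, a⟫ ≠ 1)
    (hy : ⟪y, a⟫ ≠ 1) :
    (1 - ⟪x, a⟫) * (1 - ⟪y, a⟫) * (1 - ⟪mobius a x, mobius a y⟫) = s a ^ 2 * (1 - ⟪x, y⟫) := by
  have hx' : 1 - ⟪x, a⟫ ≠ 0 := sub_ne_zero.2 hx.symm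
  have hy' : 1 - ⟪y, a⟫ ≠ 0 := sub_ne_zero.2 hy.symm
  have e : ⟪a - P a x - s a • Q a x, a - P a y - s a • Q a y⟫ =
      ‖a‖ ^ 2 - ⟪x, a⟫ - ⟪y, a⟫ + ⟪x, a⟫ * ⟪y, a⟫ + s a ^ 2 * ⟪x, y⟫ := by
    have c1 : ⟪x, P a y⟫ = ⟪P a x, y⟫ := by
      rw [real_inner_comm, ← inner_P_P, real_inner_comm, inner_P_P]
    have c2 : ⟪P a x, a⟫ = ⟪x, a⟫ := by rw [real_inner_comm, inner_P, real_inner_comm]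
    have c3 : ⟪a, y⟫ = ⟪y, a⟫ := real_inner_comm _ _
    have c4 : ⟪a, P a y⟫ = ⟪y, a⟫ := by rw [inner_P, real_inner_comm]
    rw [← norm_sq_mul_inner_P]
    simp only [Q, inner_sub_left, inner_sub_right, real_inner_smul_left, inner_smul_right,
      inner_P_P, c1, c2, c3, c4, real_inner_self_eq_norm_sq]
    linear_combination (-⟪P a x, y⟫) * s_sq ha
  rw [mobius, mobius, real_inner_smul_left, inner_smul_right, e]
  field_simp
  linear_combination -s_sq ha

/-! ### The involution of the sphere and its conformal factor. -/

/-- The conformal factor of `φ_a` on the sphere. -/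
def conformalFactor (ha : a ∈ ball (0 : E n) 1) (y : Sph n) : NNReal :=
  ⟨s a / (1 - ⟪a, (y : E n)⟫), by
    rw [real_inner_comm]
    exact div_nonneg (s_pos ha).le
      (one_sub_inner_pos ha (mem_sphere_zero_iff_norm.1 y.2).le).le⟩

theorem coe_conformalFactor (ha : a ∈ ball (0 : E n) 1) (y : Sph n) :
    (conformalFactor ha y : ℝ) = s a / (1 - ⟪(y : E n), a⟫) := by
  rw [real_inner_comm]
  rfl

theorem one_sub_inner_sphere_pos (ha : a ∈ ball (0 : E n) 1) (y : Sph n) :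
    0 < 1 - ⟪(y : E n), a⟫ :=
  one_sub_inner_pos ha (mem_sphere_zero_iff_norm.1 y.2).le

theorem inner_sphere_ne_one (ha : a ∈ ball (0 : E n) 1) (y : Sph n) : ⟪(y : E n), a⟫ ≠ 1 :=
  (sub_pos.1 (one_sub_inner_sphere_pos ha y)).ne

theorem measurable_conformalFactor (ha : a ∈ ball (0 : E n) 1) :
    Measurable (conformalFactor ha) := by
  refine Measurable.subtype_mk ?_
  fun_prop

theorem measurable_mobiusSphere (ha : a ∈ ball (0 : E n) 1) : Measurable (mobiusSphere ha) := by
  refine Measurable.subtype_mk ?_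
  simp only [mobius, Q, P]
  fun_prop

theorem mobiusSphere_involutive (ha : a ∈ ball (0 : E n) 1) :
    Function.Involutive (mobiusSphere ha) := fun y =>
  Subtype.ext (mobius_mobius ha (inner_sphere_ne_one ha y))

theorem conformalFactor_mobiusSphere (ha : a ∈ ball (0 : E n) 1) (y : Sph n) :
    conformalFactor ha (mobiusSphere ha y) * conformalFactor ha y = 1 := by
  have hd := (one_sub_inner_sphere_pos ha y).ne'
  have hs := (s_pos ha).ne'
  apply NNReal.coe_injective
  rw [NNReal.coe_mul, coe_conformalFactor, coe_conformalFactor]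
  change s a / (1 - ⟪mobius a y, a⟫) * _ = 1
  rw [one_sub_inner_mobius ha (inner_sphere_ne_one ha y)]
  field_simp

theorem dist_mobiusSphere_sq (ha : a ∈ ball (0 : E n) 1) (x y : Sph n) :
    dist (mobiusSphere ha x) (mobiusSphere ha y) ^ 2 =
      conformalFactor ha x * conformalFactor ha y * dist x y ^ 2 := by
  have hdist : ∀ u v : Sph n, dist u v ^ 2 = 2 * (1 - ⟪(u : E n), v⟫) := by
    intro u v
    rw [Subtype.dist_eq, dist_eq_norm, norm_sub_sq_real, mem_sphere_zero_iff_norm.1 u.2,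
      mem_sphere_zero_iff_norm.1 v.2]
    ring
  have hx := (one_sub_inner_sphere_pos ha x).ne'
  have hy := (one_sub_inner_sphere_pos ha y).ne'
  have h := inner_mobius_mobius ha (inner_sphere_ne_one ha x) (inner_sphere_ne_one ha y)
  rw [hdist, hdist, coe_conformalFactor, coe_conformalFactor]
  change 2 * (1 - ⟪mobius a x, mobius a y⟫) = _
  field_simp
  linear_combination h

/-- The involution `φ_a` of the sphere as a measurable equivalence. -/
def mobiusSphereEquiv (ha : a ∈ ball (0 : E n) 1) : Sph n ≃ᵐ Sph n where
  toEquiv := (mobiusSphere_involutive ha).toPerm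
  measurable_toFun := measurable_mobiusSphere ha
  measurable_invFun := measurable_mobiusSphere ha

end ShiftedFunk

end

theorem theorem3p1 {𝕜 : Type*} [RCLike 𝕜] (n k : ℕ) (hk : 1 ≤ k) (hkn : k ≤ n)
    (a : ShiftedFunk.E n) (ha : a ∈ Metric.ball (0 : ShiftedFunk.E n) 1)
    (f : C(ShiftedFunk.Sph n, 𝕜)) :
    (ShiftedFunk.funk a k f : ShiftedFunk.Gr a k → 𝕜) =
      ShiftedFunk.N ha (ShiftedFunk.funk (0 : ShiftedFunk.E n) k (ShiftedFunk.M ha k f)) := by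
  funext τ
  have hmap := map_withDensity_euclideanHausdorffMeasure_of_involutive
    (ShiftedFunk.measurable_mobiusSphere ha) (ShiftedFunk.mobiusSphere_involutive ha)
    (ShiftedFunk.measurable_conformalFactor ha) (ShiftedFunk.conformalFactor_mobiusSphere ha)
    (ShiftedFunk.dist_mobiusSphere_sq ha) (k - 1)
  have hpre : ShiftedFunk.mobiusSphereEquiv ha ⁻¹' {x : ShiftedFunk.Sph n | (x : ShiftedFunk.E n) ∈ τ.1} =
      {x : ShiftedFunk.Sph n | (x : ShiftedFunk.E n) ∈ ShiftedFunk.mobiusPlane a τ.1} := by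
    ext y
    exact ShiftedFunk.mobius_mem_iff ha τ.2.1 (ShiftedFunk.inner_sphere_ne_one ha y)
  have hmeas : MeasurableSet {x : ShiftedFunk.Sph n |
      (x : ShiftedFunk.E n) ∈ ShiftedFunk.mobiusPlane a τ.1} :=
    measurable_subtype_coe (AffineSubspace.closed_of_finiteDimensional _).measurableSet
  change ∫ x in {x : ShiftedFunk.Sph n | (x : ShiftedFunk.E n) ∈ τ.1}, f x ∂μHE[k - 1] =
    ∫ y in {y : ShiftedFunk.Sph n | (y : ShiftedFunk.E n) ∈ ShiftedFunk.mobiusPlane a τ.1},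
      ShiftedFunk.M ha k f y ∂μHE[k - 1]
  -- Only the left-hand measure is replaced, so pulling back along `φ_a` leaves `f ∘ φ_a` with the
  -- weight c^(k-1) on the section by `φ_a τ`.
  conv_lhs => rw [← hmap]
  refine (setIntegral_map_equiv (ShiftedFunk.mobiusSphereEquiv ha) _ _).trans ?_
  rw [hpre, setIntegral_withDensity_eq_setIntegral_smul
    ((ShiftedFunk.measurable_conformalFactor ha).pow_const _) _ hmeas]
  refine setIntegral_congr_fun hmeas fun y _ => ?_
  rw [NNReal.smul_def, RCLike.real_smul_eq_coe_mul, NNReal.coe_pow]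
  rfl
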